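/- Let $K$ be a field and let $S=\langle n_1,n_2,n_3,n_4\rangle$ be a 4-generated pseudo-symmetric numerical semigroup with $n_1<n_2<n_3<n_4$, where the $n_i$ are given by Komeda's formulas $$n_1=\alpha_2\alpha_3(\alpha_4-1)+1,\qquad n_2=\alpha_{21}\alpha_3\alpha_4+(\alpha_1-\alpha_{21}-1)(\alpha_3-1)+\alpha_3,$$ $$n_3=\alpha_1\alpha_4+(\alpha_1-\alpha_{21}-1)(\alpha_2-1)(\alpha_4-1)-\alpha_4+1,\qquad n_4=\alpha_1\alpha_2(\alpha_3-1)+\alpha_{21}(\alpha_2-1)+\alpha_2$$ for integers $\alpha_1,\alpha_2,\alpha_3,\alpha_4>1$ and $0<\alpha_{21}<\alpha_1-1$. Let $I_S$ be the kernel of $K[X_1,X_2,X_3,X_4]\to K[t]$, $X_i\mapsto t^{n_i}$, and suppose $\alpha_2>\alpha_{21}+1$. For $0\le j\le \alpha_4-1$ let $s_j$ be the smallest integer $s\ge 0$ with $$((\alpha_4-1)s+j)\alpha_2+\alpha_4-j< s\alpha_1+((\alpha_4-1)s+j+1)\alpha_{21}+\alpha_3-s,$$ and put $s_{-1}=0$.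 These $s_j$ exist and satisfy $s_j\le\alpha_3-1$. Put $f_2=X_2^{\alpha_2}-X_1^{\alpha_{21}}X_4$, $f_3=X_3^{\alpha_3}-X_1^{\alpha_1-\alpha_{21}-1}X_2$, $f_4=X_4^{\alpha_4}-X_1X_2^{\alpha_2-1}X_3^{\alpha_3-1}$, and $$f_{1,j}=X_1^{\alpha_1+j\alpha_{21}}-X_2^{j\alpha_2}X_3X_4^{\alpha_4-(j+1)},$$ $$g_{j,i}=X_2^{((\alpha_4-1)i+j)\alpha_2+1}X_4^{\alpha_4-(j+1)}-X_1^{i\alpha_1+((\alpha_4-1)i+j+1)\alpha_{21}+1}X_3^{\alpha_3-(i+1)}.$$ Then $$G=\{f_{1,j} : 0\le j\le\alpha_4-1\}\cup\{f_2,f_3,f_4\}\cup\{g_{j,i} : 0\le j\le \alpha_4-1,\ s_{j-1}\le i\le s_j\}$$ is a standard basis of $I_S$ (that is, $G$ is a finite subset of $I_S$ whose leading monomials generate the leading ideal of $I_S$) with respect to the negative degree reverse lexicographical ordering with $X_1>X_2>X_3>X_4$. More generally, it is one with respect to every local degree ordering (a monomial ordering for which monomials of smaller total degree are larger) such that, whenever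 $j<\alpha_4-1$, $s_{j-1}\le i<s_j$ and the two monomials of $g_{j,i}$ have equal total degree, the one in $X_1,X_3$ is the leading monomial. -/

import Mathlib

/-! ### Pseudo-symmetric numerical semigroups -/

/-- `S ⊆ ℕ` is a pseudo-symmetric numerical semigroup: the complement of `S` has a largest element
`F` (the Frobenius number; in particular the complement is finite), `F` is even, and for every
`x ∉ S` other than `F / 2` one has `F - x ∈ S`. (Integers `x < 0` and `x > F` satisfy the condition
automatically.) -/
def IsPseudoSymmetric (S : AddSubmonoid ℕ) : Prop :=
  ∃ F : ℕ, IsGreatest {x : ℕ | x ∉ S} F ∧ Even F ∧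
    ∀ x : ℕ, x ≤ F → x ∉ S → 2 * x ≠ F → F - x ∈ S

/-- The defining ideal `I_S` of the monomial curve `X_i = t ^ (n_i)`: the kernel of
`K[X₁, X₂, X₃, X₄] → K[t]`, `X_i ↦ t ^ (n_i)`. The variables `X₁, X₂, X₃, X₄` are indexed by
`0, 1, 2, 3 : Fin 4`. -/
noncomputable def definingIdeal (K : Type*) [Field K] (n : Fin 4 → ℕ) :
    Ideal (MvPolynomial (Fin 4) K) :=
  RingHom.ker (MvPolynomial.aeval (R := K) (fun i => (Polynomial.X : Polynomial K) ^ n i))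

/-! ### Local degree orderings and standard bases -/

/-- A local degree ordering on the monomials in four variables (identified with their exponent
vectors), given by its strict order relation: a total order compatible with multiplication for
which a monomial of smaller total degree is larger. -/
structure IsLocalDegreeOrder (lt : (Fin 4 →₀ ℕ) → (Fin 4 →₀ ℕ) → Prop) : Prop where
  strictTotal : IsStrictTotalOrder (Fin 4 →₀ ℕ) lt
  add_right : ∀ a b c, lt a b → lt (a + c) (b + c)
  degree : ∀ a b, a.degree < b.degree → lt b a

/-- The negative degree reverse lexicographical ordering with `X₁ > X₂ > X₃ > X₄`:
`a < b` if `a` has larger total degree, or the degrees agree and `a` has the larger exponent at the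
last variable where `a` and `b` differ. -/
def negDegRevLex (a b : Fin 4 →₀ ℕ) : Prop :=
  b.degree < a.degree ∨
    (a.degree = b.degree ∧ ∃ i : Fin 4, b i < a i ∧ ∀ k : Fin 4, i < k → a k = b k)

/-- `m` is the leading monomial of `f`: the largest monomial occurring in `f`
(so that `f` is nonzero). -/
def IsLeadingMonomial {K : Type*} [Field K] (lt : (Fin 4 →₀ ℕ) → (Fin 4 →₀ ℕ) → Prop)
    (f : MvPolynomial (Fin 4) K) (m : Fin 4 →₀ ℕ) : Prop :=
  m ∈ f.support ∧ ∀ m' ∈ f.support, m' ≠ m → lt m' m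

/-- The leading ideal of a set of polynomials: the ideal generated by the leading monomials of its
nonzero elements. -/
noncomputable def leadingIdeal {K : Type*} [Field K]
    (lt : (Fin 4 →₀ ℕ) → (Fin 4 →₀ ℕ) → Prop) (A : Set (MvPolynomial (Fin 4) K)) :
    Ideal (MvPolynomial (Fin 4) K) :=
  Ideal.span {q | ∃ f ∈ A, ∃ m, IsLeadingMonomial lt f m ∧ q = MvPolynomial.monomial m 1}

/-- `G` is a standard basis of the ideal `I`: a finite subset of `I` with the same leading ideal.
(For a local ordering, the leading monomials of the ideal generated by `I` in the localization at
the origin are those of `I` itself, as multiplication by a polynomial with nonzero constant term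
does not change the leading monomial.) -/
def IsStandardBasis {K : Type*} [Field K] (lt : (Fin 4 →₀ ℕ) → (Fin 4 →₀ ℕ) → Prop)
    (I : Ideal (MvPolynomial (Fin 4) K)) (G : Set (MvPolynomial (Fin 4) K)) : Prop :=
  G.Finite ∧ G ⊆ (I : Set (MvPolynomial (Fin 4) K)) ∧
    leadingIdeal lt G = leadingIdeal lt (I : Set (MvPolynomial (Fin 4) K))

/-! ### The parameters, the numbers `s_j` and the set `G` -/

/-- The five parameters `α₁, α₂, α₃, α₄, α₂₁`. -/
structure KomedaParams where
  (α₁ α₂ α₃ α₄ α₂₁ : ℕ)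

namespace KomedaParams

/-- `n₁, n₂, n₃, n₄` are given by Komeda's formulas in terms of the parameters `p`. -/
structure Describes (p : KomedaParams) (n : Fin 4 → ℕ) : Prop where
  one_lt_α₁ : 1 < p.α₁
  one_lt_α₂ : 1 < p.α₂
  one_lt_α₃ : 1 < p.α₃
  one_lt_α₄ : 1 < p.α₄
  α₂₁_pos : 0 < p.α₂₁
  α₂₁_lt : (p.α₂₁ : ℤ) < p.α₁ - 1
  n₁ : (n 0 : ℤ) = p.α₂ * p.α₃ * (p.α₄ - 1) + 1
  n₂ : (n 1 : ℤ) = p.α₂₁ * p.α₃ * p.α₄ + (p.α₁ - p.α₂₁ - 1) * (p.α₃ - 1) + p.α₃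
  n₃ : (n 2 : ℤ) =
    p.α₁ * p.α₄ + (p.α₁ - p.α₂₁ - 1) * (p.α₂ - 1) * (p.α₄ - 1) - p.α₄ + 1
  n₄ : (n 3 : ℤ) = p.α₁ * p.α₂ * (p.α₃ - 1) + p.α₂₁ * (p.α₂ - 1) + p.α₂

/-- The set of nonnegative integers `s` satisfying the degree inequality that defines `s_j`. -/
def sSet (p : KomedaParams) (j : ℕ) : Set ℕ :=
  {s | (((p.α₄ - 1) * s + j) * p.α₂ + p.α₄ - j : ℤ) <
    s * p.α₁ + ((p.α₄ - 1) * s + j + 1) * p.α₂₁ + p.α₃ - s}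

/-- `s_j`, the smallest element of `sSet p j`. -/
noncomputable def s (p : KomedaParams) (j : ℕ) : ℕ := sInf (p.sSet j)

/-- `s_{j-1}`, with the convention `s_{-1} = 0`. -/
noncomputable def sPrev (p : KomedaParams) : ℕ → ℕ
  | 0 => 0
  | j + 1 => p.s j

/-- The exponent vector of `X₁ ^ a * X₂ ^ b * X₃ ^ c * X₄ ^ d`. -/
noncomputable def expo (a b c d : ℕ) : Fin 4 →₀ ℕ := Finsupp.equivFunOnFinite.symm ![a, b, c, d]

/-- The monomial `X₁ ^ a * X₂ ^ b * X₃ ^ c * X₄ ^ d`. -/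
noncomputable def mon (K : Type*) [Field K] (a b c d : ℕ) : MvPolynomial (Fin 4) K :=
  MvPolynomial.monomial (expo a b c d) 1

/-- `f_{1,j}`, used for `j < α₄`. -/
noncomputable def f₁ (p : KomedaParams) (K : Type*) [Field K] (j : ℕ) : MvPolynomial (Fin 4) K :=
  mon K (p.α₁ + j * p.α₂₁) 0 0 0 - mon K 0 (j * p.α₂) 1 (p.α₄ - (j + 1))

/-- `f₂ = X₂ ^ α₂ - X₁ ^ α₂₁ X₄`. -/
noncomputable def f₂ (p : KomedaParams) (K : Type*) [Field K] : MvPolynomial (Fin 4) K :=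
  mon K 0 p.α₂ 0 0 - mon K p.α₂₁ 0 0 1

/-- `f₃ = X₃ ^ α₃ - X₁ ^ (α₁ - α₂₁ - 1) X₂`. -/
noncomputable def f₃ (p : KomedaParams) (K : Type*) [Field K] : MvPolynomial (Fin 4) K :=
  mon K 0 0 p.α₃ 0 - mon K (p.α₁ - p.α₂₁ - 1) 1 0 0

/-- `f₄ = X₄ ^ α₄ - X₁ X₂ ^ (α₂ - 1) X₃ ^ (α₃ - 1)`. -/
noncomputable def f₄ (p : KomedaParams) (K : Type*) [Field K] : MvPolynomial (Fin 4) K :=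
  mon K 0 0 0 p.α₄ - mon K 1 (p.α₂ - 1) (p.α₃ - 1) 0

/-- The exponent vector of the first monomial (in `X₂` and `X₄`) of `g_{j,i}`. -/
noncomputable def gExpo₂₄ (p : KomedaParams) (j i : ℕ) : Fin 4 →₀ ℕ :=
  expo 0 (((p.α₄ - 1) * i + j) * p.α₂ + 1) 0 (p.α₄ - (j + 1))

/-- The exponent vector of the second monomial (in `X₁` and `X₃`) of `g_{j,i}`. -/
noncomputable def gExpo₁₃ (p : KomedaParams) (j i : ℕ) : Fin 4 →₀ ℕ :=
  expo (i * p.α₁ + ((p.α₄ - 1) * i + j + 1) * p.α₂₁ + 1) 0 (p.α₃ - (i + 1)) 0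

/-- `g_{j,i}`, used for `j < α₄` and `i < α₃`. -/
noncomputable def g (p : KomedaParams) (K : Type*) [Field K] (j i : ℕ) :
    MvPolynomial (Fin 4) K :=
  MvPolynomial.monomial (p.gExpo₂₄ j i) 1 - MvPolynomial.monomial (p.gExpo₁₃ j i) 1

/-- The set `G` of all `f_{1,j}` (`0 ≤ j ≤ α₄ - 1`), `f₂`, `f₃`, `f₄` and all `g_{j,i}`
(`0 ≤ j ≤ α₄ - 1`, `s_{j-1} ≤ i ≤ s_j`). -/
def basis (p : KomedaParams) (K : Type*) [Field K] : Set (MvPolynomial (Fin 4) K) :=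
  {q | ∃ j < p.α₄, q = p.f₁ K j} ∪ {p.f₂ K, p.f₃ K, p.f₄ K} ∪
    {q | ∃ j < p.α₄, ∃ i, p.sPrev j ≤ i ∧ i ≤ p.s j ∧ q = p.g K j i}

/-- The tie-breaking convention: whenever `j < α₄ - 1`, `s_{j-1} ≤ i < s_j` and the two monomials
of `g_{j,i}` have the same total degree, the monomial in `X₁` and `X₃` is the larger one. -/
def BreaksTies (p : KomedaParams) (lt : (Fin 4 →₀ ℕ) → (Fin 4 →₀ ℕ) → Prop) : Prop :=
  ∀ j i : ℕ, j + 1 < p.α₄ → p.sPrev j ≤ i → i < p.s j →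
    (p.gExpo₂₄ j i).degree = (p.gExpo₁₃ j i).degree → lt (p.gExpo₂₄ j i) (p.gExpo₁₃ j i)

end KomedaParams

/-! Every monomial of an element of `I_S` shares its weight with another monomial of that element,
and weight classes are finite. So no S-polynomials are needed: by `isStandardBasis_of_reducible` it
suffices that of any two distinct monomials `u`, `w` of equal weight, one is divisible by the
leading monomial of an element of `G`. Komeda's formulas and coprimality give `u - w = a v₁ + b v₂ +
c v₃`, where the `vᵢ` are the exponent differences of `f_{1,0}`, `f₂`, `f₃` (`exists_combination`).
Up to exchanging `u` and `w`, the first nonzero entry of `(c, -a, -b)` is positive. If `c = 0`, some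
`f_{1,j}` or `f₂` reduces `u`. If `c > 0` and neither monomial is reducible by the `f`'s, the two
are divisible by the two monomials of one `g_{j,i}` (`reducible_of_combination`). That binomial need
not lie in `G`, but monotonicity of `s_j` provides a member of `G` that reduces one of its monomials
(`reducible_of_g`). -/

/-! ### Weights of monomials and binomials in the defining ideal -/

/-- The weight of the monomial with exponent vector `m`, where `X i` has weight `n i`. -/
def weight (n : Fin 4 → ℕ) (m : Fin 4 →₀ ℕ) : ℕ := ∑ i, n i * m i

lemma weight_add (n : Fin 4 → ℕ) (a b : Fin 4 →₀ ℕ) :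
    weight n (a + b) = weight n a + weight n b := by
  simp [weight, mul_add, Finset.sum_add_distrib]

lemma aeval_monomial_eq_weight {K : Type*} [Field K] (n : Fin 4 → ℕ) (m : Fin 4 →₀ ℕ) (c : K) :
    MvPolynomial.aeval (R := K) (fun i => (Polynomial.X : Polynomial K) ^ n i)
      (MvPolynomial.monomial m c) = Polynomial.monomial (weight n m) c := by
  rw [MvPolynomial.aeval_monomial, Finsupp.prod_fintype _ _ (fun i => by simp)]
  simp_rw [← pow_mul]
  rw [Finset.prod_pow_eq_pow_sum, ← Polynomial.C_mul_X_pow_eq_monomial]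
  rfl

lemma binomial_mem_definingIdeal {K : Type*} [Field K] {n : Fin 4 → ℕ} {a b : Fin 4 →₀ ℕ}
    (h : weight n a = weight n b) :
    (MvPolynomial.monomial a (1 : K) - MvPolynomial.monomial b 1) ∈ definingIdeal K n := by
  rw [definingIdeal, RingHom.mem_ker, map_sub, aeval_monomial_eq_weight,
    aeval_monomial_eq_weight, h, sub_self]

/-- Every monomial of an element of the defining ideal shares its weight with another one. -/
lemma exists_ne_weight_eq {K : Type*} [Field K] {n : Fin 4 → ℕ} {f : MvPolynomial (Fin 4) K}
    (hf : f ∈ definingIdeal K n) {m : Fin 4 →₀ ℕ} (hm : m ∈ f.support) :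
    ∃ m' ∈ f.support, m' ≠ m ∧ weight n m' = weight n m := by
  by_contra! h
  rw [definingIdeal, RingHom.mem_ker, MvPolynomial.as_sum f, map_sum] at hf
  have h2 := congrArg (fun q => Polynomial.coeff q (weight n m)) hf
  simp only [aeval_monomial_eq_weight, Polynomial.finsetSum_coeff, Polynomial.coeff_monomial,
    Polynomial.coeff_zero] at h2
  rw [Finset.sum_eq_single_of_mem m hm (fun b hb hbm => if_neg (h b hb hbm)), if_pos rfl] at h2
  exact MvPolynomial.mem_support_iff.1 hm h2

lemma finite_weight_eq {n : Fin 4 → ℕ} (hn : ∀ i, 0 < n i) (w : ℕ) :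
    {m : Fin 4 →₀ ℕ | weight n m = w}.Finite := by
  refine (Set.finite_Iic (Finsupp.equivFunOnFinite.symm (fun _ : Fin 4 => w))).subset ?_
  intro m hm i
  have h1 : n i * m i ≤ weight n m :=
    Finset.single_le_sum (f := fun i => n i * m i) (fun _ _ => Nat.zero_le _) (Finset.mem_univ i)
  have h2 : m i ≤ n i * m i := Nat.le_mul_of_pos_left _ (hn i)
  simp only [Set.mem_ofPred_eq] at hm
  simp only [Finsupp.equivFunOnFinite_symm_apply_apply]
  omega

/-! ### A criterion for sets of binomials to be standard bases -/

lemma isLeadingMonomial_sub {K : Type*} [Field K] {lt : (Fin 4 →₀ ℕ) → (Fin 4 →₀ ℕ) → Prop}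
    (hlt : IsLocalDegreeOrder lt) {a b : Fin 4 →₀ ℕ} (h : lt b a) :
    IsLeadingMonomial lt (MvPolynomial.monomial a (1 : K) - MvPolynomial.monomial b 1) a ∧
    IsLeadingMonomial lt (MvPolynomial.monomial b (1 : K) - MvPolynomial.monomial a 1) a := by
  have := hlt.strictTotal
  have hne : a ≠ b := by rintro rfl; exact irrefl_of lt _ h
  refine ⟨⟨?_, fun m hm hma => ?_⟩, ⟨?_, fun m hm hma => ?_⟩⟩
  · simp [MvPolynomial.mem_support_iff, MvPolynomial.coeff_monomial, hne.symm]
  · have : b = m := by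
      by_contra hb
      simp [MvPolynomial.mem_support_iff, MvPolynomial.coeff_monomial, hb, Ne.symm hma] at hm
    exact this ▸ h
  · simp [MvPolynomial.mem_support_iff, MvPolynomial.coeff_monomial, hne.symm]
  · have : b = m := by
      by_contra hb
      simp [MvPolynomial.mem_support_iff, MvPolynomial.coeff_monomial, hb, Ne.symm hma] at hm
    exact this ▸ h

/-- The monomial `u` is divisible by the leading monomial of a binomial of `G` whose two monomials
have the same weight. -/
def Reducible {K : Type*} [Field K] (n : Fin 4 → ℕ) (lt : (Fin 4 →₀ ℕ) → (Fin 4 →₀ ℕ) → Prop)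
    (G : Set (MvPolynomial (Fin 4) K)) (u : Fin 4 →₀ ℕ) : Prop :=
  ∃ a b, weight n a = weight n b ∧ lt b a ∧
    (MvPolynomial.monomial a 1 - MvPolynomial.monomial b 1 ∈ G ∨
      MvPolynomial.monomial b 1 - MvPolynomial.monomial a 1 ∈ G) ∧ a ≤ u

/-- If of two distinct monomials of the same weight one is always reducible, then `G` is a standard
basis: the smallest monomial of each weight is irreducible, so all others are reducible. -/
lemma isStandardBasis_of_reducible {K : Type*} [Field K] {n : Fin 4 → ℕ} (hn : ∀ i, 0 < n i)
    {lt : (Fin 4 →₀ ℕ) → (Fin 4 →₀ ℕ) → Prop} (hlt : IsLocalDegreeOrder lt)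
    {G : Set (MvPolynomial (Fin 4) K)} (hfin : G.Finite)
    (hG : G ⊆ (definingIdeal K n : Set (MvPolynomial (Fin 4) K)))
    (hred : ∀ u w, u ≠ w → weight n u = weight n w → Reducible n lt G u ∨ Reducible n lt G w) :
    IsStandardBasis lt (definingIdeal K n) G := by
  have := hlt.strictTotal
  refine ⟨hfin, hG, le_antisymm (Ideal.span_mono ?_) (Ideal.span_le.2 ?_)⟩
  · rintro q ⟨f, hf, m, hm, rfl⟩
    exact ⟨f, hG hf, m, hm, rfl⟩
  rintro q ⟨f, hf, m, ⟨hm, hmax⟩, rfl⟩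
  obtain ⟨m', hm', hne, hw⟩ := exists_ne_weight_eq hf hm
  -- A local order is not well-founded, but its restriction to one finite weight class is. If `m` is
  -- irreducible, the smaller monomial can be rewritten downwards within the class, which cannot go
  -- on forever.
  have key : ∀ m', weight n m' = weight n m → lt m' m → Reducible n lt G m := by
    intro m' hw'
    refine ((finite_weight_eq hn (weight n m)).wellFoundedOn (r := lt)).induction
      (P := fun m' => lt m' m → Reducible n lt G m) hw' ?_
    intro v hv ih hvm
    have hne : m ≠ v := by rintro rfl; exact irrefl_of lt _ hvm
    rcases hred m v hne hv.symm with h | ⟨a, b, hab, hba, -, hle⟩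
    · exact h
    · obtain ⟨d, rfl⟩ := exists_add_of_le hle
      have hlt' : lt (b + d) (a + d) := hlt.add_right _ _ _ hba
      refine ih (b + d) ?_ hlt' (trans_of lt hlt' hvm)
      simp only [Set.mem_ofPred_eq, weight_add] at hv ⊢
      omega
  obtain ⟨a, b, -, hba, hmem, hle⟩ := key m' hw (hmax m' hm' hne)
  have ha : (MvPolynomial.monomial a (1 : K)) ∈ leadingIdeal lt G := by
    rcases hmem with h | h
    · exact Ideal.subset_span ⟨_, h, a, (isLeadingMonomial_sub hlt hba).1, rfl⟩
    · exact Ideal.subset_span ⟨_, h, a, (isLeadingMonomial_sub hlt hba).2, rfl⟩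
  obtain ⟨d, rfl⟩ := exists_add_of_le hle
  have : MvPolynomial.monomial (a + d) (1 : K) =
      MvPolynomial.monomial d 1 * MvPolynomial.monomial a 1 := by
    rw [MvPolynomial.monomial_mul, one_mul, add_comm]
  rw [this]
  exact Ideal.mul_mem_left _ _ ha

/-! ### The negative degree reverse lexicographical ordering -/

lemma isLocalDegreeOrder_negDegRevLex : IsLocalDegreeOrder negDegRevLex where
  strictTotal :=
    { trichotomous := by
        intro a b hab hba
        simp only [negDegRevLex, not_or, not_lt, not_and, not_exists] at hab hba
        have hd : a.degree = b.degree := le_antisymm hab.1 hba.1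
        by_contra hne
        have hs : (Finset.univ.filter (fun i => a i ≠ b i)).Nonempty := by
          obtain ⟨i, hi⟩ := Finsupp.ne_iff.1 hne
          exact ⟨i, by simpa using hi⟩
        set i := (Finset.univ.filter (fun i => a i ≠ b i)).max' hs with hi
        have h1 : a i ≠ b i := by simpa using Finset.max'_mem _ hs
        have h2 : ∀ k, i < k → a k = b k := by
          intro k hk
          by_contra hc
          exact absurd (Finset.le_max' _ k (by simpa using hc)) (not_le.2 hk)
        rcases lt_or_gt_of_ne h1 with h | h
        · exact hba.2 hd.symm i h (fun k hk => (h2 k hk).symm)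
        · exact hab.2 hd i h h2
      irrefl := by
        rintro a (h | ⟨-, i, hi, -⟩)
        · exact lt_irrefl _ h
        · exact lt_irrefl _ hi
      trans := by
        rintro a b c (h | ⟨h, i, hi, hi'⟩) (h' | ⟨h', k, hk, hk'⟩)
        · exact Or.inl (h'.trans h)
        · exact Or.inl (by omega)
        · exact Or.inl (by omega)
        -- The last variable where `a` and `c` differ is the later of the two deciding variables.
        · refine Or.inr ⟨h.trans h', max i k, ?_, fun l hl => ?_⟩
          · rcases lt_trichotomy i k with hik | rfl | hik
            · rw [max_eq_right hik.le, hi' k hik]; exact hk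
            · rw [max_self]; exact hk.trans hi
            · rw [max_eq_left hik.le, ← hk' i hik]; exact hi
          · rw [hi' l (lt_of_le_of_lt (le_max_left _ _) hl),
              hk' l (lt_of_le_of_lt (le_max_right _ _) hl)] }
  add_right := by
    rintro a b c (h | ⟨h, i, hi, hi'⟩)
    · exact Or.inl (by simpa using h)
    · exact Or.inr ⟨by simp [h], i, by simpa using hi, fun k hk => by simp [hi' k hk]⟩
  degree := fun _ _ h => Or.inl h

lemma breaksTies_negDegRevLex (p : KomedaParams) : p.BreaksTies negDegRevLex := by
  intro j i hj _ _ hdeg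
  -- For `j + 1 < α₄` the variable `X₄` occurs in the first monomial only.
  refine Or.inr ⟨hdeg, 3, ?_, fun k hk => absurd hk (by omega)⟩
  simp only [KomedaParams.gExpo₂₄, KomedaParams.gExpo₁₃, KomedaParams.expo]
  simp
  omega

/-! ### The weight-zero lattice -/

/-- Two consecutive integers beyond the Frobenius number lie in the semigroup. This is all that is
needed from pseudo-symmetry. -/
lemma isUnit_of_forall_dvd {n : Fin 4 → ℕ}
    (hS : IsPseudoSymmetric (AddSubmonoid.closure (Set.range n))) {d : ℤ}
    (hd : ∀ i, d ∣ n i) : IsUnit d := by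
  obtain ⟨F, ⟨-, hF⟩, -, -⟩ := hS
  have hdvd : ∀ x ∈ AddSubmonoid.closure (Set.range n), d ∣ (x : ℤ) := by
    intro x hx
    induction hx using AddSubmonoid.closure_induction with
    | mem x h => obtain ⟨i, rfl⟩ := h; exact hd i
    | zero => simp
    | add x y _ _ h1 h2 => push_cast; exact dvd_add h1 h2
  have hmem : ∀ x, F < x → x ∈ AddSubmonoid.closure (Set.range n) := by
    intro x hx
    by_contra h
    exact absurd (hF h) (not_le.2 hx)
  have h1 := hdvd (F + 1) (hmem _ (by omega))
  have h2 := hdvd (F + 2) (hmem _ (by omega))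
  have h3 := dvd_sub h2 h1
  push_cast at h3
  rw [show ((F : ℤ) + 2 - (F + 1)) = 1 by ring] at h3
  exact isUnit_of_dvd_one h3

namespace KomedaParams

variable {p : KomedaParams} {n : Fin 4 → ℕ}

lemma Describes.rel₁ (hp : p.Describes n) :
    (p.α₁ * n 0 : ℤ) = n 2 + (p.α₄ - 1) * n 3 := by
  rw [hp.n₁, hp.n₃, hp.n₄]; ring

lemma Describes.rel₂ (hp : p.Describes n) :
    (p.α₂ * n 1 : ℤ) = p.α₂₁ * n 0 + n 3 := by
  rw [hp.n₁, hp.n₂, hp.n₄]; ring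

lemma Describes.rel₃ (hp : p.Describes n) :
    (p.α₃ * n 2 : ℤ) = (p.α₁ - p.α₂₁ - 1) * n 0 + n 1 := by
  rw [hp.n₁, hp.n₂, hp.n₃]; ring

/-- Vectors of weight zero are integral combinations of the exponent vectors of `f_{1,0}`, `f₂` and
`f₃`. -/
lemma Describes.exists_combination (hp : p.Describes n)
    (hS : IsPseudoSymmetric (AddSubmonoid.closure (Set.range n))) {x₁ x₂ x₃ x₄ : ℤ}
    (h : n 0 * x₁ + n 1 * x₂ + n 2 * x₃ + n 3 * x₄ = 0) :
    ∃ a b c : ℤ, x₁ = a * p.α₁ - b * p.α₂₁ - c * (p.α₁ - p.α₂₁ - 1) ∧ x₂ = b * p.α₂ - c ∧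
      x₃ = c * p.α₃ - a ∧ x₄ = -a * (p.α₄ - 1) - b := by
  have r₁ := hp.rel₁
  have r₂ := hp.rel₂
  have r₃ := hp.rel₃
  have n₁ := hp.n₁
  have hcop : IsCoprime (n 0 : ℤ) (n 1 : ℤ) := by
    rw [← isRelPrime_iff_isCoprime]
    intro d h0 h1
    have h3 : d ∣ n 3 := by
      rw [show (n 3 : ℤ) = p.α₂ * n 1 - p.α₂₁ * n 0 by linear_combination (-1 : ℤ) * r₂]
      exact dvd_sub (h1.mul_left _) (h0.mul_left _)
    have h2 : d ∣ n 2 := by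
      rw [show (n 2 : ℤ) = p.α₁ * n 0 - (p.α₄ - 1) * n 3 by linear_combination (-1 : ℤ) * r₁]
      exact dvd_sub (h0.mul_left _) (h3.mul_left _)
    exact isUnit_of_forall_dvd hS (fun i => by fin_cases i <;> assumption)
  -- Modulo `n 0`, the relations give `n 3 ≡ α₂ n 1` and `n 2 ≡ -(α₄ - 1) α₂ n 1`.
  have hdvd : (n 0 : ℤ) ∣ n 1 * (x₃ * (p.α₂ * (p.α₄ - 1)) - x₄ * p.α₂ - x₂) := by
    refine ⟨x₁ + x₃ * (p.α₁ + (p.α₄ - 1) * p.α₂₁) - x₄ * p.α₂₁, ?_⟩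
    linear_combination (-1 : ℤ) * h + (x₃ * (p.α₄ - 1) - x₄) * r₂ - x₃ * r₁
  obtain ⟨c, hc⟩ := hcop.dvd_of_dvd_mul_left hdvd
  have hx₂ : x₂ = (-(c * p.α₃ - x₃) * (p.α₄ - 1) - x₄) * p.α₂ - c := by
    linear_combination (-1 : ℤ) * hc - c * n₁
  -- The equations for `x₃` and `x₄` force `a` and `b` once `c` is known; the one for `x₁` follows
  -- by cancelling `n 0`.
  refine ⟨c * p.α₃ - x₃, -(c * p.α₃ - x₃) * (p.α₄ - 1) - x₄, c, ?_, hx₂, by ring, by ring⟩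
  have h0 : (n 0 : ℤ) ≠ 0 := by
    have h2 := hp.one_lt_α₂
    have h3 := hp.one_lt_α₃
    have h4 := hp.one_lt_α₄
    rw [n₁]
    have : (0 : ℤ) ≤ p.α₂ * p.α₃ * (p.α₄ - 1) := by
      have : (0 : ℤ) ≤ p.α₄ - 1 := by omega
      positivity
    omega
  refine mul_left_cancel₀ h0 ?_
  rw [hx₂] at h
  linear_combination h - (c * p.α₃ - x₃) * r₁ - (-(c * p.α₃ - x₃) * (p.α₄ - 1) - x₄) * r₂ - c * r₃

lemma expo_le_iff {a b c d : ℕ} {u : Fin 4 →₀ ℕ} :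
    expo a b c d ≤ u ↔ a ≤ u 0 ∧ b ≤ u 1 ∧ c ≤ u 2 ∧ d ≤ u 3 := by
  rw [Finsupp.le_def, Fin.forall_fin_succ, Fin.forall_fin_succ, Fin.forall_fin_succ,
    Fin.forall_fin_one]
  rfl

lemma degree_expo (a b c d : ℕ) : (expo a b c d).degree = a + b + c + d := by
  rw [Finsupp.degree_eq_sum, Fin.sum_univ_four]
  rfl

lemma weight_expo (a b c d : ℕ) :
    weight n (expo a b c d) = n 0 * a + n 1 * b + n 2 * c + n 3 * d := by
  rw [weight, Fin.sum_univ_four]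
  rfl

/-! ### Weights of the elements of `G` -/

lemma Describes.weight_f₁ (hp : p.Describes n) {j : ℕ} (hj : j < p.α₄) :
    weight n (expo (p.α₁ + j * p.α₂₁) 0 0 0) =
      weight n (expo 0 (j * p.α₂) 1 (p.α₄ - (j + 1))) := by
  rw [weight_expo, weight_expo]
  zify [Nat.succ_le_of_lt hj]
  linear_combination hp.rel₁ - j * hp.rel₂

lemma Describes.weight_f₂ (hp : p.Describes n) :
    weight n (expo 0 p.α₂ 0 0) = weight n (expo p.α₂₁ 0 0 1) := by
  rw [weight_expo, weight_expo]
  zify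
  linear_combination hp.rel₂

lemma Describes.weight_f₃ (hp : p.Describes n) :
    weight n (expo 0 0 p.α₃ 0) = weight n (expo (p.α₁ - p.α₂₁ - 1) 1 0 0) := by
  have h := hp.α₂₁_lt
  rw [weight_expo, weight_expo]
  zify [show p.α₂₁ ≤ p.α₁ by omega, show 1 ≤ p.α₁ - p.α₂₁ by omega]
  linear_combination hp.rel₃

lemma Describes.weight_f₄ (hp : p.Describes n) :
    weight n (expo 0 0 0 p.α₄) = weight n (expo 1 (p.α₂ - 1) (p.α₃ - 1) 0) := by
  rw [weight_expo, weight_expo]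
  zify [hp.one_lt_α₂.le, hp.one_lt_α₃.le]
  linear_combination -hp.rel₁ - hp.rel₂ - hp.rel₃

lemma Describes.weight_g (hp : p.Describes n) {j i : ℕ} (hj : j < p.α₄) (hi : i < p.α₃) :
    weight n (p.gExpo₂₄ j i) = weight n (p.gExpo₁₃ j i) := by
  rw [gExpo₂₄, gExpo₁₃, weight_expo, weight_expo]
  zify [Nat.succ_le_of_lt hj, Nat.succ_le_of_lt hi, hp.one_lt_α₄.le]
  linear_combination ((p.α₄ - 1) * i + j) * hp.rel₂ - (i + 1) * hp.rel₁ - hp.rel₃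

/-! ### Degrees of the elements of `G` -/

/-- The weights agree and `X₁` is the lightest variable, so its pure power has the larger degree.
Similar weight comparisons settle `f₃` and `f₄`. -/
lemma Describes.degree_f₁ (hp : p.Describes n) (hn : StrictMono n) {j : ℕ} (hj : j < p.α₄) :
    (expo 0 (j * p.α₂) 1 (p.α₄ - (j + 1))).degree < (expo (p.α₁ + j * p.α₂₁) 0 0 0).degree := by
  have h := hp.weight_f₁ hj
  rw [weight_expo, weight_expo] at h
  rw [degree_expo, degree_expo]
  have h1 : n 0 < n 1 := hn (by decide)
  have h2 : n 0 < n 2 := hn (by decide)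
  have h3 : n 0 < n 3 := hn (by decide)
  by_contra! hc
  nlinarith [Nat.mul_le_mul_left (n 0) hc, Nat.mul_le_mul_right (j * p.α₂) h1.le,
    Nat.mul_le_mul_right (p.α₄ - (j + 1)) h3.le]

lemma degree_f₂ (hα : p.α₂₁ + 1 < p.α₂) :
    (expo p.α₂₁ 0 0 1).degree < (expo 0 p.α₂ 0 0).degree := by
  rw [degree_expo, degree_expo]
  omega

lemma Describes.degree_f₃ (hp : p.Describes n) (hn : StrictMono n) :
    (expo 0 0 p.α₃ 0).degree < (expo (p.α₁ - p.α₂₁ - 1) 1 0 0).degree := by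
  have h := hp.weight_f₃
  rw [weight_expo, weight_expo] at h
  rw [degree_expo, degree_expo]
  have h1 : n 0 < n 2 := hn (by decide)
  have h2 : n 1 < n 2 := hn (by decide)
  by_contra! hc
  nlinarith [Nat.mul_le_mul_left (n 2) hc, Nat.mul_le_mul_right (p.α₁ - p.α₂₁ - 1) h1.le]

lemma Describes.degree_f₄ (hp : p.Describes n) (hn : StrictMono n) :
    (expo 0 0 0 p.α₄).degree < (expo 1 (p.α₂ - 1) (p.α₃ - 1) 0).degree := by
  have h := hp.weight_f₄
  rw [weight_expo, weight_expo] at h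
  rw [degree_expo, degree_expo]
  have h1 : n 0 < n 3 := hn (by decide)
  have h2 : n 1 < n 3 := hn (by decide)
  have h3 : n 2 < n 3 := hn (by decide)
  by_contra! hc
  nlinarith [Nat.mul_le_mul_left (n 3) hc, Nat.mul_le_mul_right (p.α₂ - 1) h2.le,
    Nat.mul_le_mul_right (p.α₃ - 1) h3.le]

/-- The inequality defining `s_j` says that the first monomial of `g_{j,i}` has smaller degree. -/
lemma Describes.degree_g (hp : p.Describes n) {j i : ℕ} (hj : j < p.α₄) (hi : i < p.α₃) :
    (p.gExpo₂₄ j i).degree < (p.gExpo₁₃ j i).degree ↔ i ∈ p.sSet j := by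
  rw [gExpo₂₄, gExpo₁₃, degree_expo, degree_expo, sSet, Set.mem_ofPred_eq]
  zify [Nat.succ_le_of_lt hj, Nat.succ_le_of_lt hi, hp.one_lt_α₄.le]
  constructor <;> intro h <;> linarith

/-- At `i = α₃ - 1` the factor `X₃` disappears from `g_{j,i}`, leaving a pure power of the lightest
variable. -/
lemma Describes.pred_mem_sSet (hp : p.Describes n) (hn : StrictMono n) {j : ℕ} (hj : j < p.α₄) :
    p.α₃ - 1 ∈ p.sSet j := by
  have hα₃ := hp.one_lt_α₃
  have hi : p.α₃ - 1 < p.α₃ := by omega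
  rw [← hp.degree_g hj hi]
  have h := hp.weight_g hj hi
  rw [gExpo₂₄, gExpo₁₃, Nat.sub_add_cancel hα₃.le, Nat.sub_self] at *
  rw [weight_expo, weight_expo] at h
  rw [degree_expo, degree_expo]
  have h1 : n 0 < n 1 := hn (by decide)
  have h3 : n 0 < n 3 := hn (by decide)
  generalize ((p.α₄ - 1) * (p.α₃ - 1) + j) * p.α₂ = b at *
  by_contra! hc
  nlinarith [Nat.mul_le_mul_left (n 0) hc, Nat.mul_le_mul_right b h1.le,
    Nat.mul_le_mul_right (p.α₄ - (j + 1)) h3.le]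

lemma Describes.isLeast_s (hp : p.Describes n) (hn : StrictMono n) {j : ℕ} (hj : j < p.α₄) :
    IsLeast (p.sSet j) (p.s j) ∧ p.s j < p.α₃ := by
  have h := hp.pred_mem_sSet hn hj
  have hα₃ := hp.one_lt_α₃
  have hle : p.s j ≤ p.α₃ - 1 := Nat.sInf_le h
  exact ⟨⟨Nat.sInf_mem ⟨_, h⟩, fun _ hx => Nat.sInf_le hx⟩, by omega⟩

/-- Raising `j` by one adds `α₂ - 1` to the left side of the defining inequality and only `α₂₁` to
the right, so the sets `sSet` shrink. -/
lemma Describes.sPrev_le_s (hp : p.Describes n) (hn : StrictMono n) (hα : p.α₂₁ + 1 < p.α₂)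
    {j : ℕ} (hj : j < p.α₄) : p.sPrev j ≤ p.s j := by
  rcases j with _ | j
  · exact Nat.zero_le _
  · refine Nat.sInf_le ?_
    have h := (hp.isLeast_s hn hj).1.1
    rw [sSet, Set.mem_ofPred_eq] at h ⊢
    push_cast at h
    have : (p.α₂₁ : ℤ) + 1 < p.α₂ := by exact_mod_cast hα
    linarith

/-! ### The set `G` -/

variable {K : Type*} [Field K]

lemma basis_finite : (p.basis K).Finite := by
  refine (Set.Finite.union ?_ (by simp)).union ?_
  · refine ((Set.finite_Iio p.α₄).image (p.f₁ K)).subset ?_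
    rintro q ⟨j, hj, rfl⟩
    exact ⟨j, hj, rfl⟩
  · refine ((Set.finite_Iio p.α₄).biUnion
      (fun j _ => (Set.finite_Iic (p.s j)).image (p.g K j))).subset ?_
    rintro q ⟨j, hj, i, -, hi, rfl⟩
    exact Set.mem_biUnion (show j ∈ Set.Iio p.α₄ from hj) ⟨i, hi, rfl⟩

lemma Describes.basis_subset (hp : p.Describes n) (hn : StrictMono n) :
    p.basis K ⊆ (definingIdeal K n : Set (MvPolynomial (Fin 4) K)) := by
  rintro q ((⟨j, hj, rfl⟩ | rfl | rfl | rfl) | ⟨j, hj, i, -, hi, rfl⟩)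
  · exact binomial_mem_definingIdeal (hp.weight_f₁ hj)
  · exact binomial_mem_definingIdeal hp.weight_f₂
  · exact binomial_mem_definingIdeal hp.weight_f₃
  · exact binomial_mem_definingIdeal hp.weight_f₄
  · exact binomial_mem_definingIdeal (hp.weight_g hj (hi.trans_lt (hp.isLeast_s hn hj).2))

lemma f₁_mem_basis {j : ℕ} (hj : j < p.α₄) : p.f₁ K j ∈ p.basis K := Or.inl (Or.inl ⟨j, hj, rfl⟩)

lemma g_mem_basis {j i : ℕ} (hj : j < p.α₄) (h : p.sPrev j ≤ i) (h' : i ≤ p.s j) :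
    p.g K j i ∈ p.basis K := Or.inr ⟨j, hj, i, h, h', rfl⟩

/-! ### Reducible monomials -/

variable {lt : (Fin 4 →₀ ℕ) → (Fin 4 →₀ ℕ) → Prop} {u w : Fin 4 →₀ ℕ}

lemma Describes.reducible_of_f₁ (hp : p.Describes n) (hn : StrictMono n)
    (hlt : IsLocalDegreeOrder lt) {j : ℕ} (hj : j < p.α₄) (h₂ : j * p.α₂ ≤ u 1) (h₃ : 1 ≤ u 2)
    (h₄ : p.α₄ ≤ u 3 + j + 1) : Reducible n lt (p.basis K) u :=
  ⟨_, _, (hp.weight_f₁ hj).symm, hlt.degree _ _ (hp.degree_f₁ hn hj), Or.inr (f₁_mem_basis hj),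
    expo_le_iff.2 ⟨Nat.zero_le _, h₂, h₃, by omega⟩⟩

lemma Describes.reducible_of_f₂ (hp : p.Describes n) (hα : p.α₂₁ + 1 < p.α₂)
    (hlt : IsLocalDegreeOrder lt) (h₁ : p.α₂₁ ≤ u 0) (h₄ : 1 ≤ u 3) :
    Reducible n lt (p.basis K) u :=
  ⟨_, _, hp.weight_f₂.symm, hlt.degree _ _ (degree_f₂ hα),
    Or.inr (Or.inl (Or.inr (Or.inl rfl))), expo_le_iff.2 ⟨h₁, Nat.zero_le _, Nat.zero_le _, h₄⟩⟩

lemma Describes.reducible_of_f₃ (hp : p.Describes n) (hn : StrictMono n)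
    (hlt : IsLocalDegreeOrder lt) (h₃ : p.α₃ ≤ u 2) : Reducible n lt (p.basis K) u :=
  ⟨_, _, hp.weight_f₃, hlt.degree _ _ (hp.degree_f₃ hn),
    Or.inl (Or.inl (Or.inr (Or.inr (Or.inl rfl)))),
    expo_le_iff.2 ⟨Nat.zero_le _, Nat.zero_le _, h₃, Nat.zero_le _⟩⟩

lemma Describes.reducible_of_f₄ (hp : p.Describes n) (hn : StrictMono n)
    (hlt : IsLocalDegreeOrder lt) (h₄ : p.α₄ ≤ u 3) : Reducible n lt (p.basis K) u :=
  ⟨_, _, hp.weight_f₄, hlt.degree _ _ (hp.degree_f₄ hn),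
    Or.inl (Or.inl (Or.inr (Or.inr (Or.inr rfl)))),
    expo_le_iff.2 ⟨Nat.zero_le _, Nat.zero_le _, Nat.zero_le _, h₄⟩⟩

lemma gExpo₂₄_le_gExpo₂₄ {j i i' : ℕ} (h : i ≤ i') : p.gExpo₂₄ j i ≤ p.gExpo₂₄ j i' := by
  rw [gExpo₂₄, expo_le_iff]
  refine ⟨Nat.zero_le _, ?_, Nat.zero_le _, le_rfl⟩
  change _ ≤ ((p.α₄ - 1) * i' + j) * p.α₂ + 1
  gcongr

lemma gExpo₁₃_le_gExpo₁₃ {j j' i : ℕ} (h : j ≤ j') : p.gExpo₁₃ j i ≤ p.gExpo₁₃ j' i := by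
  rw [gExpo₁₃, expo_le_iff]
  refine ⟨?_, Nat.zero_le _, le_rfl, Nat.zero_le _⟩
  change _ ≤ i * p.α₁ + ((p.α₄ - 1) * i + j' + 1) * p.α₂₁ + 1
  gcongr

/-- For all `j` and `i`, also those for which `g_{j,i}` is not in `G`, one of the monomials of
`g_{j,i}` is reducible. -/
lemma Describes.reducible_of_g (hp : p.Describes n) (hn : StrictMono n) (hα : p.α₂₁ + 1 < p.α₂)
    (hlt : IsLocalDegreeOrder lt) (hties : p.BreaksTies lt) {j i : ℕ} (hj : j < p.α₄)
    (hi : i < p.α₃) (hw : p.gExpo₂₄ j i ≤ w) (hu : p.gExpo₁₃ j i ≤ u) :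
    Reducible n lt (p.basis K) u ∨ Reducible n lt (p.basis K) w := by
  have := hlt.strictTotal
  by_cases hex : ∃ k ≤ j, i < p.s k
  · classical
    -- Minimality of `k` gives `s_{k-1} ≤ i < s_k`, so `g_{k,i}` lies in `G`; its monomial in `X₁`,
    -- `X₃` divides that of `g_{j,i}`.
    obtain ⟨k, ⟨hkj, hik⟩, hmin⟩ : ∃ k, (k ≤ j ∧ i < p.s k) ∧ ∀ l < k, ¬ (l ≤ j ∧ i < p.s l) :=
      ⟨Nat.find hex, Nat.find_spec hex, fun _ => Nat.find_min hex⟩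
    have hprev : p.sPrev k ≤ i := by
      rcases hk' : k with _ | l
      · exact Nat.zero_le _
      · by_contra! hc
        subst hk'
        exact hmin l (by omega) ⟨by omega, hc⟩
    have hkα : k < p.α₄ := by omega
    have hmem := g_mem_basis (K := K) hkα hprev hik.le
    have hwt := hp.weight_g hkα hi
    rcases trichotomous_of lt (p.gExpo₂₄ k i) (p.gExpo₁₃ k i) with h | h | h
    · exact Or.inl ⟨_, _, hwt.symm, h, Or.inr hmem, (gExpo₁₃_le_gExpo₁₃ hkj).trans hu⟩
    · have h0 := congrArg (fun v => v 0) h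
      simp [gExpo₂₄, gExpo₁₃, expo] at h0
    · have hnd : ¬ (p.gExpo₂₄ k i).degree < (p.gExpo₁₃ k i).degree := by
        rw [hp.degree_g hkα hi]
        exact fun hc => absurd ((hp.isLeast_s hn hkα).1.2 hc) (not_le.2 hik)
      rcases lt_or_eq_of_le (not_lt.1 hnd) with hd | hd
      · exact absurd (trans_of lt h (hlt.degree _ _ hd)) (irrefl_of lt _)
      · by_cases hlast : k + 1 < p.α₄
        · exact absurd (trans_of lt h (hties k i hlast hprev hik hd.symm)) (irrefl_of lt _)
        -- For `k = α₄ - 1` ties may break either way, but then `g_{j,i}` itself lies in `G`.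
        · obtain rfl : k = j := by omega
          exact Or.inr ⟨_, _, hwt, h, Or.inl hmem, hw⟩
  -- Now `s_j ≤ i`, and the monomial of `g_{j,s_j}` in `X₂`, `X₄` leads and divides that of
  -- `g_{j,i}`.
  · push Not at hex
    obtain ⟨hs, hsα⟩ := hp.isLeast_s hn hj
    exact Or.inr ⟨_, _, hp.weight_g hj hsα, hlt.degree _ _ ((hp.degree_g hj hsα).2 hs.1),
      Or.inl (g_mem_basis hj (hp.sPrev_le_s hn hα hj) le_rfl),
      (gExpo₂₄_le_gExpo₂₄ (hex j le_rfl)).trans hw⟩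

lemma Describes.reducible_of_combination (hp : p.Describes n) (hn : StrictMono n)
    (hα : p.α₂₁ + 1 < p.α₂) (hlt : IsLocalDegreeOrder lt) (hties : p.BreaksTies lt) {a b c : ℤ}
    (hpos : 0 < c ∨ c = 0 ∧ (a < 0 ∨ a = 0 ∧ b < 0))
    (h₁ : (u 0 - w 0 : ℤ) = a * p.α₁ - b * p.α₂₁ - c * (p.α₁ - p.α₂₁ - 1))
    (h₂ : (u 1 - w 1 : ℤ) = b * p.α₂ - c) (h₃ : (u 2 - w 2 : ℤ) = c * p.α₃ - a)
    (h₄ : (u 3 - w 3 : ℤ) = -a * (p.α₄ - 1) - b) :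
    Reducible n lt (p.basis K) u ∨ Reducible n lt (p.basis K) w := by
  by_contra! hred
  obtain ⟨hu, hw⟩ := hred
  have hα₁ := hp.α₂₁_lt
  have hα₂ := hp.one_lt_α₂
  have hα₃ := hp.one_lt_α₃
  have hα₄ := hp.one_lt_α₄
  have hu₂ : u 2 < p.α₃ := by
    by_contra! h
    exact hu (hp.reducible_of_f₃ hn hlt h)
  have hu₃ : u 3 < p.α₄ := by
    by_contra! h
    exact hu (hp.reducible_of_f₄ hn hlt h)
  have hw₃ : w 3 < p.α₄ := by
    by_contra! h
    exact hw (hp.reducible_of_f₄ hn hlt h)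
  have hα₄' : (0 : ℤ) ≤ p.α₄ - 1 := by omega
  rcases hpos with hc | ⟨rfl, ha | ⟨rfl, hb⟩⟩
  -- From `u 2 < α₃` one gets `a > (c - 1) α₃`, hence `a ≥ c`; then `w 3 < α₄` makes `-b`
  -- nonnegative. So `X₁ ^ α₂₁` divides `u`, and `f₂` excludes `X₄` from `u`.
  · have hca : (c - 1) * (p.α₃ - 1) ≥ 0 := mul_nonneg (by omega) (by omega)
    have ha : c ≤ a := by nlinarith
    have hb : (p.α₄ - 1) - w 3 ≤ -b := by nlinarith
    have hx₁ : (p.α₂₁ : ℤ) + 1 ≤ u 0 := by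
      have e₁ : 0 ≤ (a - c) * (p.α₁ - p.α₂₁ - 1 : ℤ) := mul_nonneg (by omega) (by omega)
      have e₂ : 0 ≤ -b * p.α₂₁ := mul_nonneg (by omega) (by omega)
      have e₃ : 0 ≤ (a - 1) * (p.α₂₁ + 1 : ℤ) := mul_nonneg (by omega) (by omega)
      have e₄ : (0 : ℤ) ≤ w 0 := by positivity
      linarith
    have hu₃' : u 3 = 0 := by
      by_contra h
      exact hu (hp.reducible_of_f₂ hα hlt (by omega) (by omega))
    have hjb : ((p.α₄ - 1 - w 3 : ℕ) : ℤ) = p.α₄ - 1 - w 3 := by omega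
    have hw₂ : w 2 = 0 := by
      by_contra h
      refine hw (hp.reducible_of_f₁ hn hlt (j := p.α₄ - 1 - w 3) (by omega) ?_ (by omega)
        (by omega))
      zify
      rw [hjb]
      have e₁ := mul_le_mul_of_nonneg_right hb (Int.natCast_nonneg p.α₂)
      linarith [Int.natCast_nonneg (u 1)]
    have hi : ((p.α₃ - 1 - u 2 : ℕ) : ℤ) = p.α₃ - 1 - u 2 := by omega
    rw [hu₃'] at h₄
    rw [hw₂] at h₃
    have ha' : (p.α₃ : ℤ) - u 2 + (c - 1) * p.α₃ = a := by
      push_cast at h₃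
      linarith
    have hc₃ : (c - 1) ≤ (c - 1) * p.α₃ := by nlinarith
    have hb' : (p.α₄ - 1) * (p.α₃ - 1 - u 2 : ℤ) + (p.α₄ - 1 - w 3) ≤ -b := by
      have e₁ : 0 ≤ (p.α₄ - 1 : ℤ) * (a - (p.α₃ - u 2)) := mul_nonneg hα₄' (by linarith)
      push_cast at h₄
      linarith
    -- The indices `j`, `i` are read off by matching the `X₄`-exponent of `w` and the `X₃`-exponent
    -- of `u` with those of `g_{j,i}`.
    have hR := hp.reducible_of_g (K := K) (u := u) (w := w) hn hα hlt hties
      (j := p.α₄ - 1 - w 3) (i := p.α₃ - 1 - u 2) (by omega) (by omega)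
      (expo_le_iff.2 ⟨Nat.zero_le _, ?_, Nat.zero_le _, by omega⟩)
      (expo_le_iff.2 ⟨?_, Nat.zero_le _, by omega, Nat.zero_le _⟩)
    · exact hR.elim hu hw
    · zify [hα₄.le]
      rw [hjb, hi]
      have e₁ := mul_le_mul_of_nonneg_right hb' (Int.natCast_nonneg p.α₂)
      linarith [Int.natCast_nonneg (u 1)]
    · zify [hα₄.le]
      rw [hjb, hi]
      have e₁ := mul_le_mul_of_nonneg_right hb' (Int.natCast_nonneg p.α₂₁)
      have e₂ : (c - 1) * (p.α₁ - p.α₂₁ - 1 : ℤ) ≤ (a - (p.α₃ - u 2)) * p.α₁ :=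
        mul_le_mul (by linarith) (by omega) (by omega) (by linarith)
      linarith [Int.natCast_nonneg (w 0)]
  -- With `c = 0` and `a < 0`, `X₃` divides `u`, and `h₄` makes `b` large enough for the required
  -- power of `X₂`.
  · refine hu (hp.reducible_of_f₁ hn hlt (j := p.α₄ - 1 - u 3) (by omega) ?_ (by omega)
      (by omega))
    have hb : (p.α₄ - 1) - u 3 ≤ b := by nlinarith
    have e₁ := mul_le_mul_of_nonneg_right hb (Int.natCast_nonneg p.α₂)
    zify
    rw [show ((p.α₄ - 1 - u 3 : ℕ) : ℤ) = p.α₄ - 1 - u 3 by omega]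
    linarith [Int.natCast_nonneg (w 1)]
  · refine hu (hp.reducible_of_f₂ hα hlt ?_ (by omega))
    have e₁ : 0 ≤ (-b - 1) * p.α₂₁ := mul_nonneg (by omega) (by omega)
    zify
    linarith [Int.natCast_nonneg (w 0)]

lemma Describes.reducible_or_reducible (hp : p.Describes n)
    (hS : IsPseudoSymmetric (AddSubmonoid.closure (Set.range n))) (hn : StrictMono n)
    (hα : p.α₂₁ + 1 < p.α₂) (hlt : IsLocalDegreeOrder lt) (hties : p.BreaksTies lt)
    (huw : u ≠ w) (hwt : weight n u = weight n w) :
    Reducible n lt (p.basis K) u ∨ Reducible n lt (p.basis K) w := by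
  have h : (n 0 * (u 0 - w 0) + n 1 * (u 1 - w 1) + n 2 * (u 2 - w 2) + n 3 * (u 3 - w 3) : ℤ)
      = 0 := by
    simp only [weight, Fin.sum_univ_four] at hwt
    zify at hwt
    linarith
  obtain ⟨a, b, c, h₁, h₂, h₃, h₄⟩ := hp.exists_combination hS h
  by_cases hpos : 0 < c ∨ c = 0 ∧ (a < 0 ∨ a = 0 ∧ b < 0)
  · exact hp.reducible_of_combination hn hα hlt hties hpos h₁ h₂ h₃ h₄
  by_cases hneg : 0 < -c ∨ -c = 0 ∧ (-a < 0 ∨ -a = 0 ∧ -b < 0)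
  · exact (hp.reducible_of_combination hn hα hlt hties hneg (by linarith) (by linarith)
      (by linarith) (by linarith)).symm
  obtain ⟨rfl, rfl, rfl⟩ : a = 0 ∧ b = 0 ∧ c = 0 := by omega
  refine absurd (Finsupp.ext fun i => ?_) huw
  fin_cases i <;> simp <;> omega

lemma Describes.isStandardBasis (hp : p.Describes n)
    (hS : IsPseudoSymmetric (AddSubmonoid.closure (Set.range n))) (hn : StrictMono n)
    (hα : p.α₂₁ + 1 < p.α₂) (hlt : IsLocalDegreeOrder lt) (hties : p.BreaksTies lt) :
    IsStandardBasis lt (definingIdeal K n) (p.basis K) := by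
  have h0 : 0 < n 0 := by
    have h := hp.n₁
    have : (0 : ℤ) ≤ p.α₂ * p.α₃ * (p.α₄ - 1) :=
      mul_nonneg (by positivity) (by have := hp.one_lt_α₄; omega)
    omega
  exact isStandardBasis_of_reducible (fun i => h0.trans_le (hn.monotone (Fin.zero_le i))) hlt
    basis_finite (hp.basis_subset hn)
    fun _ _ huw hwt => hp.reducible_or_reducible hS hn hα hlt hties huw hwt

end KomedaParams

theorem theorem1 {K : Type*} [Field K] (n : Fin 4 → ℕ) (p : KomedaParams)
    (hS : IsPseudoSymmetric (AddSubmonoid.closure (Set.range n)))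
    (hp : p.Describes n)
    (hn : StrictMono n)
    (hα : p.α₂₁ + 1 < p.α₂) :
    (∀ j < p.α₄, IsLeast (p.sSet j) (p.s j) ∧ p.s j < p.α₃) ∧
    IsStandardBasis negDegRevLex (definingIdeal K n) (p.basis K) ∧
    ∀ lt : (Fin 4 →₀ ℕ) → (Fin 4 →₀ ℕ) → Prop,
      IsLocalDegreeOrder lt → p.BreaksTies lt →
        IsStandardBasis lt (definingIdeal K n) (p.basis K) :=
  ⟨fun _ hj => hp.isLeast_s hn hj,
    hp.isStandardBasis hS hn hα isLocalDegreeOrder_negDegRevLex (breaksTies_negDegRevLex p),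
    fun _ hlt hties => hp.isStandardBasis hS hn hα hlt hties⟩
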